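/- **Theorem 18.** Let $K$ be a locally compact field with a nontrivial non-Archimedean absolute value, let $X\neq\{0\}$ be a non-Archimedean Banach space over $K$ of separable type (some countable subset has dense $K$-linear span), and let $X^*$ be the space of continuous $K$-linear functionals on $X$. Let $s$ be a prime, let $K_s$ be a locally compact non-Archimedean valued field extending $\mathbb{Q}_s$, let $U_s$ be a complete non-Archimedean valued field extending $K_s$, and let $\chi:(K,+)\to U_s^\times$ be a nontrivial continuous character whose values are roots of unity. A $K_s$-valued *measure* on the algebra $\mathrm{Bco}(X)$ of all clopen subsets of $X$ is a bounded finitely additive map $\mu:\mathrm{Bco}(X)\to K_s$ such that $\lim_{A\in\mathcal A}\mu(A)=0$ for every nonempty downward directed family $\mathcal A\subset \mathrm{Bco}(X)$ with empty intersection. Put $\|A\|_\mu=\sup\{|\mu(B)|: B\subset A,\ B\in \mathrm{Bco}(X)\}$ and $N_\mu(x)=\inf\{\|A\|_\mu: x\in A\in \mathrm{Bco}(X)\}$. A function $\varphi:X\to U_s$ is integrable with integral $\int\varphi\,d\mu$ if it is a limit, in the seminorm $\sup_x|\varphi(x)|N_\mu(x)$, of locally constant functions with finitely many values whose integrals tend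 to $\int\varphi\,d\mu$. The characteristic functional of $\mu$ is $\hat\mu(y)=\int_X\chi(y(x))\,\mu(dx)$, $y\in X^*$. For $x_0\in X$ put $\mu_{x_0}(A)=\mu(-x_0+A)$. Call $\mu$ *Gaussian in the usual sense* if 1. for every $y\in X^*\setminus\{0\}$, $\hat\mu(ty)\to 0$ as $t\in K$, $|t|\to\infty$; and 2. there are $x_0\in X$, a $K$-bilinear form $g:X^*\times X^*\to K$, a compact injective continuous $K$-linear operator $T:X^*\to X^*$, and an exponential function $f:K\to U_s^\times$, i.e. $f(a+b)=f(a)f(b)$ for all $a,b\in K$, such that $\hat\mu_{x_0}(y)=f(g(Ty,Ty))$ for all $y\in X^*$. Then there is no $K_s$-valued measure on $\mathrm{Bco}(X)$, and in particular no nontrivial probability measure, that is Gaussian in the usual sense. -/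

import Mathlib

open Filter Topology TopologicalSpace

/-- An `F`-valued measure on the algebra `Bco X` of all clopen subsets of `X`, where `F` is a
non-Archimedean field: a bounded finitely additive set function which tends to zero along every
shrinking family (downward directed family with empty intersection) of clopen sets. -/
structure BcoMeasure (X F : Type*) [TopologicalSpace X] [NormedField F] where
  /-- the value on a clopen set -/
  toFun : Clopens X → F
  add_of_disjoint : ∀ A B : Clopens X, Disjoint A B → toFun (A ⊔ B) = toFun A + toFun B
  bounded : ∃ C : ℝ, ∀ A : Clopens X, ‖toFun A‖ ≤ C
  shrinking : ∀ 𝒜 : Set (Clopens X), 𝒜.Nonempty → DirectedOn (fun A B => B ≤ A) 𝒜 →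
    (⋂ A ∈ 𝒜, (A : Set X)) = ∅ →
    ∀ ε : ℝ, 0 < ε → ∃ A ∈ 𝒜, ∀ B ∈ 𝒜, B ≤ A → ‖toFun B‖ ≤ ε

namespace BcoMeasure

/-- The preimage of a clopen set under a continuous map. -/
def clopenPreimage {X Y : Type*} [TopologicalSpace X] [TopologicalSpace Y] (h : C(X, Y))
    (A : Clopens Y) : Clopens X :=
  ⟨h ⁻¹' (A : Set Y), A.isClopen.preimage h.continuous⟩

/-- The image of a measure under a continuous map. -/
def map {X Y F : Type*} [TopologicalSpace X] [TopologicalSpace Y] [NormedField F]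
    (μ : BcoMeasure X F) (h : C(X, Y)) : BcoMeasure Y F where
  toFun A := μ.toFun (clopenPreimage h A)
  add_of_disjoint A B hAB := by
    have hd : Disjoint (clopenPreimage h A) (clopenPreimage h B) := by
      rw [disjoint_iff_inf_le] at hAB ⊢
      intro x hx
      exact hAB (show h x ∈ A ⊓ B from hx)
    exact μ.add_of_disjoint _ _ hd
  bounded := by
    obtain ⟨C, hC⟩ := μ.bounded
    exact ⟨C, fun A => hC _⟩
  shrinking := by
    intro 𝒜 hne hdir hemp ε hε
    have hmono : ∀ A B : Clopens Y, A ≤ B → clopenPreimage h A ≤ clopenPreimage h B :=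
      fun A B hAB x hx => hAB (show h x ∈ A from hx)
    obtain ⟨A', ⟨A, hA, rfl⟩, hA'⟩ := μ.shrinking (clopenPreimage h '' 𝒜) (hne.image _)
      (by
        rintro _ ⟨A, hA, rfl⟩ _ ⟨B, hB, rfl⟩
        obtain ⟨C, hC, hCA, hCB⟩ := hdir A hA B hB
        exact ⟨_, ⟨C, hC, rfl⟩, hmono _ _ hCA, hmono _ _ hCB⟩)
      (by
        rw [Set.eq_empty_iff_forall_notMem] at hemp ⊢
        intro x hx
        refine hemp (h x) ?_
        simp only [Set.mem_iInter] at hx ⊢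
        intro A hA
        exact hx _ ⟨A, hA, rfl⟩)
      ε hε
    exact ⟨A, hA, fun B hB hBA => hA' _ ⟨B, hB, rfl⟩ (hmono _ _ hBA)⟩

/-- The shifted measure `A ↦ μ (-a + A)`, that is, the image of `μ` under `x ↦ x + a`. -/
def shift {X F : Type*} [TopologicalSpace X] [AddGroup X] [ContinuousAdd X] [NormedField F]
    (μ : BcoMeasure X F) (a : X) : BcoMeasure X F :=
  μ.map ⟨fun x => x + a, continuous_id.add continuous_const⟩

/-- The norm `‖A‖_μ = sup {‖μ B‖ : B ⊆ A clopen}` of a clopen set. -/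
noncomputable def setNorm {X F : Type*} [TopologicalSpace X] [NormedField F]
    (μ : BcoMeasure X F) (A : Clopens X) : ℝ :=
  ⨆ B : {B : Clopens X // B ≤ A}, ‖μ.toFun B‖

/-- The weight `N_μ(x) = inf {‖A‖_μ : A a clopen neighbourhood of x}`. -/
noncomputable def weight {X F : Type*} [TopologicalSpace X] [NormedField F]
    (μ : BcoMeasure X F) (x : X) : ℝ :=
  ⨅ A : {A : Clopens X // x ∈ A}, μ.setNorm A

/-- The integral `∑ c, μ {g = c} • c` of a clopen step function `g` (meant for locally constant
`g` with finitely many values). -/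
noncomputable def stepIntegral {X F U : Type*} [TopologicalSpace X] [NormedField F]
    [NormedField U] [NormedAlgebra F U] (μ : BcoMeasure X F) (g : LocallyConstant X U) : U :=
  ∑ᶠ c : U, μ.toFun ⟨g ⁻¹' {c}, g.isLocallyConstant.isClopen_fiber c⟩ • c

/-- `μ.HasIntegral φ I`: the function `φ` is `μ`-integrable with `∫ φ dμ = I`, i.e. `φ` is a limit,
in the seminorm `‖φ‖_μ = sup_x ‖φ x‖ N_μ(x)`, of clopen step functions with integrals tending
to `I`. -/
def HasIntegral {X F U : Type*} [TopologicalSpace X] [NormedField F]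
    [NormedField U] [NormedAlgebra F U] (μ : BcoMeasure X F) (φ : X → U) (I : U) : Prop :=
  ∀ ε : ℝ, 0 < ε → ∃ g : LocallyConstant X U, (Set.range g).Finite ∧
    (∀ x, ‖φ x - g x‖ * μ.weight x ≤ ε) ∧ ‖μ.stepIntegral g - I‖ ≤ ε

section

variable {K X F U : Type*} [NontriviallyNormedField K] [NormedAddCommGroup X] [NormedSpace K X]
  [NormedField F] [NormedField U] [NormedAlgebra F U]

/-- `θ` is the characteristic functional `y ↦ ∫ χ(y(x)) μ(dx)` of `μ`, on the space of all
continuous linear functionals `y : X → K`. -/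
def IsCharFunctional (μ : BcoMeasure X F) (χ : AddChar K U) (θ : StrongDual K X → U) : Prop :=
  ∀ y : StrongDual K X, μ.HasIntegral (fun x => χ (y x)) (θ y)

/-- Gaussian measures in the usual sense. The characteristic functional tends to zero at infinity
along each line of the dual space, and, after a shift of `μ` by some vector `x₀`, it is
`y ↦ f (g (T y, T y))`, where `g` is bilinear, `T` is a compact injective operator and `f` is an
exponential function, `f (a + b) = f a * f b` (in the classical case `f a = exp (- a / 2)`), so
that covariances of convolutions add up. -/
structure IsUsualGaussian (μ : BcoMeasure X F) (χ : AddChar K U) : Prop where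
  tendsto_zero : ∃ θ : StrongDual K X → U, μ.IsCharFunctional χ θ ∧
    ∀ y : StrongDual K X, y ≠ 0 →
      Tendsto (fun t : K => θ (t • y)) (Bornology.cobounded K) (𝓝 0)
  exponential_form : ∃ (x₀ : X) (f : AddChar K U)
    (g : StrongDual K X →ₗ[K] StrongDual K X →ₗ[K] K)
    (T : StrongDual K X →L[K] StrongDual K X),
      IsCompactOperator T ∧ Function.Injective T ∧
      (μ.shift x₀).IsCharFunctional χ (fun y => f (g (T y) (T y)))

end

end BcoMeasure

/-!
The two conditions contradict each other already on a single line of the dual space.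

A locally compact field is spherically complete, so Hahn–Banach holds over `K`
(`LinearPMap.exists_extension_of_norm_le`) and there is a functional `y ≠ 0` on `X`. Integrals are
unique (`HasIntegral.unique`), because the shrinking condition bounds `‖μ A‖` by the supremum of the
weight over `A` (`norm_toFun_le_of_weight_le`). Hence translating `μ` by `x₀` multiplies its
characteristic functional `θ` by `χ (y x₀)` (`IsCharFunctional.eq_mul_of_shift`), a root of unity,
so a factor of norm one. With `a = g (T y) (T y)` the exponential form then reads
`‖f (t ^ 2 * a)‖ = ‖θ (t • y)‖`, which tends to `0` as `‖t‖ → ∞`.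

No exponential function `f` behaves like that (`AddChar.not_tendsto_sq_mul_zero`). Since `K` is
locally compact, some integer `n > 0` has `‖n‖ < 1` in `K`. If `n = 0` in `K`, then
`f b ^ n = f (n • b) = 1` for every `b`, so all values of `f` have norm one. Otherwise `t = n⁻ᵏ`
tends to infinity while `f (t ^ 2 * a) ^ n ^ (2 * k) = f a`, so `‖f (t ^ 2 * a)‖` is at least
`min 1 ‖f a‖`.
-/

/-! ### Continuous linear functionals over a locally compact non-Archimedean field -/

section HahnBanach

variable {K X : Type*} [NontriviallyNormedField K] [IsUltrametricDist K] [LocallyCompactSpace K]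
  [NormedAddCommGroup X] [NormedSpace K X] [IsUltrametricDist X]

/-- The value that an extension of `f` with the same bound may take at `y`. The balls in `K` that it
has to meet are nested by the ultrametric inequality, and compact, so they have a common point. -/
theorem LinearPMap.exists_forall_norm_sub_le (f : X →ₗ.[K] K) {C : ℝ} (hC : 0 ≤ C)
    (hf : ∀ x : f.domain, ‖f x‖ ≤ C * ‖(x : X)‖) (y : X) :
    ∃ c : K, ∀ x : f.domain, ‖f x - c‖ ≤ C * ‖(x : X) - y‖ := by
  have : ProperSpace K := .of_locallyCompactSpace K
  have hball : ∀ x x' : f.domain, ‖(x : X) - y‖ ≤ ‖(x' : X) - y‖ →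
      Metric.closedBall (f x) (C * ‖(x : X) - y‖) ⊆
        Metric.closedBall (f x') (C * ‖(x' : X) - y‖) := by
    intro x x' hxx' z hz
    rw [Metric.mem_closedBall] at hz ⊢
    refine (dist_triangle_max z (f x) (f x')).trans (max_le (hz.trans (by gcongr)) ?_)
    rw [dist_eq_norm, ← f.map_sub]
    refine (hf _).trans (mul_le_mul_of_nonneg_left ?_ hC)
    have h := dist_triangle_max (x : X) y (x' : X)
    rw [dist_comm y, dist_eq_norm, dist_eq_norm, dist_eq_norm] at h
    exact h.trans (max_le hxx' le_rfl)
  obtain ⟨c, hc⟩ := IsCompact.nonempty_iInter_of_directed_nonempty_isCompact_isClosed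
    (fun x : f.domain => Metric.closedBall (f x) (C * ‖(x : X) - y‖))
    (by
      intro x x'
      rcases le_total ‖(x : X) - y‖ ‖(x' : X) - y‖ with h | h
      · exact ⟨x, subset_rfl, hball _ _ h⟩
      · exact ⟨x', hball _ _ h, subset_rfl⟩)
    (fun x => ⟨f x, Metric.mem_closedBall_self (by positivity)⟩)
    (fun x => isCompact_closedBall _ _) (fun x => Metric.isClosed_closedBall)
  refine ⟨c, fun x => ?_⟩
  have h := Set.mem_iInter.1 hc x
  rwa [Metric.mem_closedBall, dist_comm, dist_eq_norm] at h

theorem LinearPMap.exists_lt_of_norm_le (f : X →ₗ.[K] K) {C : ℝ} (hC : 0 ≤ C)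
    (hf : ∀ x : f.domain, ‖f x‖ ≤ C * ‖(x : X)‖) (hdom : f.domain ≠ ⊤) :
    ∃ g, f < g ∧ ∀ x : g.domain, ‖g x‖ ≤ C * ‖(x : X)‖ := by
  obtain ⟨y, -, hy⟩ : ∃ y ∈ (⊤ : Submodule K X), y ∉ f.domain :=
    SetLike.exists_of_lt (lt_top_iff_ne_top.2 hdom)
  obtain ⟨c, hc⟩ := f.exists_forall_norm_sub_le hC hf y
  refine ⟨f.supSpanSingleton y c hy, lt_iff_le_not_ge.2 ⟨f.left_le_sup _ _, fun H => ?_⟩, ?_⟩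
  · replace H := LinearPMap.domain_mono.monotone H
    rw [LinearPMap.domain_supSpanSingleton, sup_le_iff, Submodule.span_le,
      Set.singleton_subset_iff] at H
    exact hy H.2
  · rintro ⟨z, hz⟩
    rcases Submodule.mem_sup.1 hz with ⟨x, hx, y', hy', rfl⟩
    rcases Submodule.mem_span_singleton.1 hy' with ⟨r, rfl⟩
    rw [LinearPMap.supSpanSingleton_apply_mk _ _ _ _ _ hx]
    simp only [RingHom.id_apply, smul_eq_mul]
    rcases eq_or_ne r 0 with rfl | hr
    · simpa using hf ⟨x, hx⟩
    · have h := hc (-r⁻¹ • ⟨x, hx⟩)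
      have h1 : f ⟨x, hx⟩ + r * c = -r * (f (-r⁻¹ • ⟨x, hx⟩) - c) := by
        rw [f.map_smul, smul_eq_mul]
        field_simp
        ring
      have h2 : x + r • y = -r • (((-r⁻¹ • (⟨x, hx⟩ : f.domain) : f.domain) : X) - y) := by
        simp [smul_sub, smul_smul, hr]
      rw [h1, h2, norm_mul, norm_smul]
      calc _ ≤ ‖-r‖ * (C * _) := mul_le_mul_of_nonneg_left h (norm_nonneg _)
        _ = _ := by ring

/-- The Hahn–Banach theorem over a locally compact non-Archimedean field: a bounded functional on a
subspace extends to the whole space with the same bound. -/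
theorem LinearPMap.exists_extension_of_norm_le (f : X →ₗ.[K] K) {C : ℝ} (hC : 0 ≤ C)
    (hf : ∀ x : f.domain, ‖f x‖ ≤ C * ‖(x : X)‖) :
    ∃ φ : StrongDual K X, (∀ x : f.domain, φ x = f x) ∧ ‖φ‖ ≤ C := by
  set S := {p : X →ₗ.[K] K | ∀ x : p.domain, ‖p x‖ ≤ C * ‖(x : X)‖}
  have hSc : ∀ c, c ⊆ S → IsChain (· ≤ ·) c → ∀ y ∈ c, ∃ ub ∈ S, ∀ z ∈ c, z ≤ ub := by
    intro c hcs c_chain y hy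
    have cne : c.Nonempty := ⟨y, hy⟩
    have hcd : DirectedOn (· ≤ ·) c := c_chain.directedOn
    refine ⟨LinearPMap.sSup c hcd, ?_, fun _ ↦ LinearPMap.le_sSup hcd⟩
    rintro ⟨x, hx⟩
    obtain ⟨p, hpc, hpx⟩ := (LinearPMap.mem_domain_sSup_iff cne hcd).1 hx
    have h : p ≤ LinearPMap.sSup c hcd := LinearPMap.le_sSup _ hpc
    have h2 : p ⟨x, hpx⟩ = LinearPMap.sSup c hcd ⟨x, hx⟩ := h.2 rfl
    rw [← h2]
    exact hcs hpc ⟨x, hpx⟩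
  obtain ⟨q, hfq, hqS, hq⟩ := zorn_le_nonempty₀ S hSc f hf
  have hdom : q.domain = ⊤ := by
    by_contra hdom
    obtain ⟨r, hqr, hr⟩ := q.exists_lt_of_norm_le hC hqS hdom
    exact hqr.not_ge (hq hr hqr.le)
  let ψ : X →ₗ[K] K := q.toFun ∘ₗ LinearMap.codRestrict q.domain LinearMap.id
    (fun x => hdom ▸ Submodule.mem_top)
  have hψ : ∀ x, ‖ψ x‖ ≤ C * ‖x‖ := fun x => hqS ⟨x, hdom ▸ Submodule.mem_top⟩
  refine ⟨ψ.mkContinuous C hψ, fun x => ?_, ψ.mkContinuous_norm_le hC hψ⟩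
  exact (hfq.2 (x := x) (y := ⟨x, hdom ▸ Submodule.mem_top⟩) rfl).symm

variable (K X) in
theorem exists_strongDual_ne_zero_of_isUltrametricDist [Nontrivial X] :
    ∃ φ : StrongDual K X, φ ≠ 0 := by
  obtain ⟨x, hx⟩ := exists_ne (0 : X)
  obtain ⟨φ, hφ, -⟩ :=
    (LinearPMap.mkSpanSingleton (K := K) x (1 : K) hx).exists_extension_of_norm_le
    (C := ‖x‖⁻¹) (by positivity) (by
      rintro ⟨z, hz⟩
      obtain ⟨r, rfl⟩ := Submodule.mem_span_singleton.1 hz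
      unfold LinearPMap.mkSpanSingleton
      rw [LinearPMap.mkSpanSingleton'_apply]
      have : ‖x‖ ≠ 0 := norm_ne_zero_iff.2 hx
      simp only [RingHom.id_apply, smul_eq_mul, mul_one, norm_smul]
      field_simp
      rfl)
  refine ⟨φ, fun h => ?_⟩
  have h1 := hφ ⟨x, Submodule.mem_span_singleton_self x⟩
  rw [LinearPMap.mkSpanSingleton_apply, h] at h1
  simp at h1

end HahnBanach

/-! ### Exponential functions -/

/-- The natural numbers lie in the compact unit ball, so two of them are at distance less than one;
their difference is the required integer. -/
theorem exists_natCast_norm_lt_one (K : Type*) [NormedField K] [IsUltrametricDist K]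
    [ProperSpace K] : ∃ n : ℕ, n ≠ 0 ∧ ‖(n : K)‖ < 1 := by
  obtain ⟨a, -, φ, hφ, hlim⟩ := (isCompact_closedBall (0 : K) 1).tendsto_subseq
    (x := fun n : ℕ => (n : K)) fun n => by
      simpa using IsUltrametricDist.norm_natCast_le_one K n
  obtain ⟨N, hN⟩ := Metric.cauchySeq_iff'.1 hlim.cauchySeq 1 one_pos
  have hlt : φ N < φ (N + 1) := hφ N.lt_succ_self
  refine ⟨φ (N + 1) - φ N, by omega, ?_⟩
  have h := hN (N + 1) N.le_succ
  rwa [dist_eq_norm, Function.comp_apply, Function.comp_apply, ← Nat.cast_sub hlt.le] at h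

namespace AddChar

/-- Passing from `m • b` to `b` takes an `m`-th root of `‖f‖`, which can make it small only if it was
small before. -/
theorem min_one_norm_le {K U : Type*} [AddMonoid K] [NormedDivisionRing U] (f : AddChar K U)
    {m : ℕ} (hm : m ≠ 0) (b : K) : min 1 ‖f (m • b)‖ ≤ ‖f b‖ := by
  rw [map_nsmul_eq_pow, norm_pow]
  rcases le_total 1 ‖f b‖ with h | h
  · exact (min_le_left _ _).trans h
  · exact (min_le_right _ _).trans (pow_le_of_le_one (norm_nonneg _) h hm)

/-- An exponential function does not tend to zero along `t ↦ t ^ 2 * a`. -/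
theorem not_tendsto_sq_mul_zero {K U : Type*} [NontriviallyNormedField K] [IsUltrametricDist K]
    [LocallyCompactSpace K] [NormedField U] (f : AddChar K U) (a : K) :
    ¬ Tendsto (fun t : K => f (t ^ 2 * a)) (Bornology.cobounded K) (𝓝 0) := by
  intro h
  have : ProperSpace K := .of_locallyCompactSpace K
  obtain ⟨n, hn, hn1⟩ := exists_natCast_norm_lt_one K
  have hne : ∀ b : K, 0 < ‖f b‖ := fun b => norm_pos_iff.2 (f.val_isUnit b).ne_zero
  rcases eq_or_ne (n : K) 0 with h0 | h0
  -- In positive characteristic `f` takes values of norm one only.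
  · obtain ⟨t, ht⟩ := (h.norm.eventually (gt_mem_nhds (by simp : ‖(0 : U)‖ < 1))).exists
    have h1 := f.min_one_norm_le hn (t ^ 2 * a)
    rw [nsmul_eq_mul, h0, zero_mul, map_zero_eq_one, norm_one, min_self] at h1
    exact ht.not_ge h1
  -- In characteristic zero, go to infinity along the powers of `n⁻¹`.
  · have hlim : Tendsto (fun k : ℕ => ((n : K)⁻¹) ^ k) atTop (Bornology.cobounded K) := by
      rw [← tendsto_norm_atTop_iff_cobounded]
      simp only [norm_pow, norm_inv]
      exact tendsto_pow_atTop_atTop_of_one_lt ((one_lt_inv₀ (norm_pos_iff.2 h0)).2 hn1)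
    obtain ⟨k, hk⟩ := ((h.comp hlim).norm.eventually (gt_mem_nhds
      (by simpa using hne a : ‖(0 : U)‖ < min 1 ‖f a‖))).exists
    have h1 := f.min_one_norm_le (m := n ^ (k * 2)) (pow_ne_zero _ hn) (((n : K)⁻¹ ^ k) ^ 2 * a)
    rw [nsmul_eq_mul, Nat.cast_pow, ← pow_mul, ← mul_assoc, ← mul_pow, mul_inv_cancel₀ h0, one_pow,
      one_mul, pow_mul] at h1
    exact hk.not_ge h1

end AddChar

/-! ### Set norms and weights of measures -/

namespace BcoMeasure

section Weight

variable {X F : Type*} [TopologicalSpace X] [NormedField F] (μ : BcoMeasure X F)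

theorem toFun_bot : μ.toFun ⊥ = 0 := by
  simpa using μ.add_of_disjoint ⊥ ⊥ disjoint_bot_left

theorem toFun_inf_add_sdiff (A B : Clopens X) : μ.toFun (A ⊓ B) + μ.toFun (A \ B) = μ.toFun A := by
  rw [← μ.add_of_disjoint _ _ disjoint_inf_sdiff, sup_inf_sdiff]

theorem bddAbove_range_norm (A : Clopens X) :
    BddAbove (Set.range fun B : {B : Clopens X // B ≤ A} => ‖μ.toFun B‖) := by
  obtain ⟨C, hC⟩ := μ.bounded
  exact ⟨C, by rintro _ ⟨B, rfl⟩; exact hC B⟩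

theorem norm_toFun_le_setNorm {A B : Clopens X} (h : B ≤ A) : ‖μ.toFun B‖ ≤ μ.setNorm A :=
  le_ciSup (μ.bddAbove_range_norm A) ⟨B, h⟩

theorem setNorm_le {A : Clopens X} {c : ℝ} (h : ∀ B ≤ A, ‖μ.toFun B‖ ≤ c) : μ.setNorm A ≤ c :=
  have : Nonempty {B : Clopens X // B ≤ A} := ⟨⟨A, le_rfl⟩⟩
  ciSup_le fun B => h B B.2

theorem setNorm_nonneg (A : Clopens X) : 0 ≤ μ.setNorm A :=
  (norm_nonneg _).trans (μ.norm_toFun_le_setNorm le_rfl)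

theorem setNorm_sup_le [IsUltrametricDist F] (A B : Clopens X) :
    μ.setNorm (A ⊔ B) ≤ max (μ.setNorm A) (μ.setNorm B) := by
  refine μ.setNorm_le fun C hC => ?_
  rw [← μ.toFun_inf_add_sdiff C A]
  refine (IsUltrametricDist.norm_add_le_max _ _).trans (max_le_max ?_ ?_)
  · exact μ.norm_toFun_le_setNorm inf_le_right
  · exact μ.norm_toFun_le_setNorm (sdiff_le_iff.2 hC)

theorem weight_le_setNorm {A : Clopens X} {x : X} (hx : x ∈ A) : μ.weight x ≤ μ.setNorm A :=
  ciInf_le (f := fun A : {A : Clopens X // x ∈ A} => μ.setNorm A)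
    ⟨0, by rintro _ ⟨B, rfl⟩; exact μ.setNorm_nonneg _⟩ ⟨A, hx⟩

theorem le_weight {x : X} {c : ℝ} (h : ∀ A : Clopens X, x ∈ A → c ≤ μ.setNorm A) :
    c ≤ μ.weight x :=
  have : Nonempty {A : Clopens X // x ∈ A} := ⟨⟨⊤, trivial⟩⟩
  le_ciInf fun A => h A A.2

theorem weight_nonneg (x : X) : 0 ≤ μ.weight x :=
  μ.le_weight fun A _ => μ.setNorm_nonneg A

theorem exists_setNorm_lt {x : X} {c : ℝ} (h : μ.weight x < c) :
    ∃ A : Clopens X, x ∈ A ∧ μ.setNorm A < c := by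
  by_contra! hc
  exact h.not_ge (μ.le_weight hc)

/-- The sets `A \ V`, with `V` of set norm at most `c`, form a shrinking family: the family of these
`V` is closed under unions as `F` is non-Archimedean, and they cover `A` by hypothesis. So some
`A \ V` has a measure of norm at most `c`, as has `A ⊓ V`. -/
theorem norm_toFun_le_of_weight_lt [IsUltrametricDist F] {A : Clopens X} {c : ℝ} (hc : 0 < c)
    (h : ∀ x ∈ A, μ.weight x < c) : ‖μ.toFun A‖ ≤ c := by
  obtain ⟨_, ⟨V, hV, rfl⟩, hAV⟩ := μ.shrinking ((fun V => A \ V) '' {V | μ.setNorm V ≤ c})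
    (Set.Nonempty.image _ ⟨⊥, μ.setNorm_le fun B hB => by
      rw [le_bot_iff.1 hB, toFun_bot, norm_zero]; exact hc.le⟩)
    (by
      rintro _ ⟨V, hV, rfl⟩ _ ⟨W, hW, rfl⟩
      exact ⟨_, ⟨V ⊔ W, (μ.setNorm_sup_le V W).trans (max_le hV hW), rfl⟩,
        sdiff_le_sdiff_left le_sup_left, sdiff_le_sdiff_left le_sup_right⟩)
    (by
      rw [Set.eq_empty_iff_forall_notMem]
      intro x hx
      simp only [Set.mem_image, Set.mem_ofPred_eq, Set.iInter_exists, Set.biInter_and',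
        Set.iInter_iInter_eq_right, Set.mem_iInter, Clopens.coe_sdiff, Set.mem_sdiff] at hx
      have hxA : x ∈ A := (hx ⊥ (μ.setNorm_le fun B hB => by
        rw [le_bot_iff.1 hB, toFun_bot, norm_zero]; exact hc.le)).1
      obtain ⟨V, hxV, hV⟩ := μ.exists_setNorm_lt (h x hxA)
      exact (hx V hV.le).2 hxV)
    c hc
  rw [← μ.toFun_inf_add_sdiff A V]
  exact (IsUltrametricDist.norm_add_le_max _ _).trans (max_le
    ((μ.norm_toFun_le_setNorm inf_le_right).trans hV) (hAV _ ⟨V, hV, rfl⟩ le_rfl))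

theorem norm_toFun_le_of_weight_le [IsUltrametricDist F] {A : Clopens X} {c : ℝ} (hc : 0 ≤ c)
    (h : ∀ x ∈ A, μ.weight x ≤ c) : ‖μ.toFun A‖ ≤ c :=
  le_of_forall_gt_imp_ge_of_dense fun _ hd =>
    μ.norm_toFun_le_of_weight_lt (hc.trans_lt hd) fun x hx => (h x hx).trans_lt hd

end Weight

/-! ### Integrals of step functions -/

section StepIntegral

variable {X F U V : Type*} [TopologicalSpace X] [NormedField F] (μ : BcoMeasure X F)

/-- The fiber `{h = d}` of a locally constant function, as a clopen set. -/
def fiber (h : LocallyConstant X V) (d : V) : Clopens X :=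
  ⟨h ⁻¹' {d}, h.isLocallyConstant.isClopen_fiber d⟩

theorem mem_fiber {h : LocallyConstant X V} {d : V} {x : X} : x ∈ fiber h d ↔ h x = d := Iff.rfl

theorem toFun_eq_sum_inf_fiber (h : LocallyConstant X V) (T : Finset V) :
    ∀ A : Clopens X, (∀ x ∈ A, h x ∈ T) → μ.toFun A = ∑ d ∈ T, μ.toFun (A ⊓ fiber h d) := by
  classical
  induction T using Finset.induction_on with
  | empty =>
    intro A hA
    have : A = ⊥ := le_bot_iff.1 fun x hx => absurd (hA x hx) (Finset.notMem_empty _)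
    rw [this, toFun_bot, Finset.sum_empty]
  | insert d T hd ih =>
    intro A hA
    rw [Finset.sum_insert hd, ← μ.toFun_inf_add_sdiff A (fiber h d), ih (A \ fiber h d)]
    · congr 1
      refine Finset.sum_congr rfl fun e he => congrArg μ.toFun (SetLike.ext fun x => ?_)
      constructor
      · rintro ⟨⟨hx, -⟩, hxe⟩
        exact ⟨hx, hxe⟩
      · rintro ⟨hx, hxe⟩
        refine ⟨⟨hx, fun hxd => hd ?_⟩, hxe⟩
        rwa [← mem_fiber.1 hxd, mem_fiber.1 hxe]
    · rintro x ⟨hx, hxd⟩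
      exact (Finset.mem_insert.1 (hA x hx)).resolve_left hxd

variable [NormedField U] [NormedAlgebra F U]

/-- The integral of `G ∘ h` can be computed on the partition into fibers of `h`. For a pair
`h = (g₁, g₂)` this integrates two step functions on a common partition. -/
theorem stepIntegral_map (h : LocallyConstant X V) (T : Finset V) (hT : ∀ x, h x ∈ T)
    (G : V → U) : μ.stepIntegral (h.map G) = ∑ d ∈ T, μ.toFun (fiber h d) • G d := by
  classical
  have hfib : ∀ c, μ.toFun (fiber (h.map G) c) = ∑ d ∈ T with G d = c, μ.toFun (fiber h d) := by
    intro c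
    rw [μ.toFun_eq_sum_inf_fiber h T _ fun x _ => hT x, Finset.sum_filter]
    refine Finset.sum_congr rfl fun d _ => ?_
    split_ifs with hd
    · refine congrArg μ.toFun (inf_eq_right.2 fun x hx => ?_)
      rw [mem_fiber] at hx ⊢
      rw [LocallyConstant.map_apply, Function.comp_apply, hx, hd]
    · rw [← μ.toFun_bot]
      refine congrArg μ.toFun (le_bot_iff.1 fun x hx => hd ?_)
      have h1 : (h.map G) x = c := hx.1
      rwa [LocallyConstant.map_apply, Function.comp_apply, mem_fiber.1 hx.2] at h1
  change ∑ᶠ c : U, μ.toFun (fiber (h.map G) c) • c = _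
  rw [finsum_eq_sum_of_support_subset (s := T.image G),
    ← Finset.sum_fiberwise_of_maps_to (t := T.image G) fun d => Finset.mem_image_of_mem G]
  · refine Finset.sum_congr rfl fun c _ => ?_
    rw [hfib, Finset.sum_smul]
    exact Finset.sum_congr rfl fun d hd => by rw [(Finset.mem_filter.1 hd).2]
  · intro c hc
    by_contra hcT
    refine hc ?_
    change μ.toFun (fiber (h.map G) c) • c = 0
    rw [hfib, Finset.filter_false_of_mem, Finset.sum_empty, zero_smul]
    exact fun d hd hdc => hcT (Finset.mem_coe.2 (Finset.mem_image.2 ⟨d, hd, hdc⟩))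

theorem stepIntegral_map_mul (c : U) (g : LocallyConstant X U) (hg : (Set.range g).Finite) :
    μ.stepIntegral (g.map (c * ·)) = c * μ.stepIntegral g := by
  have hT : ∀ x, g x ∈ hg.toFinset := fun x => hg.mem_toFinset.2 ⟨x, rfl⟩
  have h1 := μ.stepIntegral_map g _ hT (id : U → U)
  rw [LocallyConstant.map_id] at h1
  rw [id_eq] at h1
  rw [μ.stepIntegral_map g _ hT, h1, Finset.mul_sum]
  simp

/-- On step functions the integral is a contraction for the seminorm `sup_x ‖φ x‖ N_μ(x)`. -/
theorem norm_stepIntegral_sub_le [IsUltrametricDist F] [IsUltrametricDist U]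
    {g h : LocallyConstant X U} (hg : (Set.range g).Finite) (hh : (Set.range h).Finite) {ε : ℝ}
    (hε : 0 ≤ ε) (H : ∀ x, ‖g x - h x‖ * μ.weight x ≤ ε) :
    ‖μ.stepIntegral g - μ.stepIntegral h‖ ≤ ε := by
  let p : LocallyConstant X (U × U) :=
    ⟨fun x => (g x, h x), g.isLocallyConstant.prodMk h.isLocallyConstant⟩
  have hT : ∀ x, p x ∈ hg.toFinset ×ˢ hh.toFinset := fun x => Finset.mem_product.2
    ⟨hg.mem_toFinset.2 ⟨x, rfl⟩, hh.mem_toFinset.2 ⟨x, rfl⟩⟩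
  have h1 := μ.stepIntegral_map p _ hT Prod.fst
  have h2 := μ.stepIntegral_map p _ hT Prod.snd
  rw [show p.map Prod.fst = g from rfl] at h1
  rw [show p.map Prod.snd = h from rfl] at h2
  rw [h1, h2, ← Finset.sum_sub_distrib]
  refine IsUltrametricDist.norm_sum_le_of_forall_le_of_nonneg hε fun d _ => ?_
  rw [← smul_sub, norm_smul]
  rcases eq_or_ne d.1 d.2 with hd | hd
  · simpa [hd] using hε
  · have hpos : 0 < ‖d.1 - d.2‖ := norm_pos_iff.2 (sub_ne_zero.2 hd)
    rw [← le_div_iff₀ hpos]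
    refine μ.norm_toFun_le_of_weight_le (by positivity) fun x hx => ?_
    rw [le_div_iff₀' hpos]
    have hx' : (g x, h x) = d := hx
    simpa [← hx'] using H x

end StepIntegral

/-! ### Uniqueness, scaling and translation of integrals -/

section Integral

variable {X F U : Type*} [TopologicalSpace X] [NormedField F] [NormedField U] [NormedAlgebra F U]
  {μ : BcoMeasure X F}

theorem HasIntegral.unique [IsUltrametricDist F] [IsUltrametricDist U] {φ : X → U} {I J : U}
    (hI : μ.HasIntegral φ I) (hJ : μ.HasIntegral φ J) : I = J := by
  refine eq_of_forall_dist_le fun ε hε => ?_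
  obtain ⟨g, hg, hgφ, hgI⟩ := hI ε hε
  obtain ⟨h, hh, hhφ, hhJ⟩ := hJ ε hε
  have hgh := μ.norm_stepIntegral_sub_le hg hh hε.le fun x => by
    calc ‖g x - h x‖ * μ.weight x ≤ max ‖φ x - g x‖ ‖φ x - h x‖ * μ.weight x := by
          refine mul_le_mul_of_nonneg_right ?_ (μ.weight_nonneg x)
          rw [← dist_eq_norm, ← dist_eq_norm, ← dist_eq_norm, dist_comm (φ x) (g x)]
          exact dist_triangle_max _ _ _
      _ ≤ ε := by
          rw [max_mul_of_nonneg _ _ (μ.weight_nonneg x)]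
          exact max_le (hgφ x) (hhφ x)
  rw [← dist_eq_norm] at hgI hhJ hgh
  refine (dist_triangle_max I (μ.stepIntegral g) J).trans (max_le (by rwa [dist_comm]) ?_)
  exact (dist_triangle_max _ (μ.stepIntegral h) J).trans (max_le hgh hhJ)

theorem HasIntegral.const_mul_of_norm_eq_one {φ : X → U} {I : U} (hI : μ.HasIntegral φ I) {c : U}
    (hc : ‖c‖ = 1) : μ.HasIntegral (fun x => c * φ x) (c * I) := by
  intro ε hε
  obtain ⟨g, hg, hgφ, hgI⟩ := hI ε hε
  refine ⟨g.map (c * ·), ?_, fun x => ?_, ?_⟩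
  · rw [LocallyConstant.map_apply, Set.range_comp]
    exact hg.image _
  · rw [LocallyConstant.map_apply, Function.comp_apply, ← mul_sub, norm_mul, hc, one_mul]
    exact hgφ x
  · rwa [μ.stepIntegral_map_mul c g hg, ← mul_sub, norm_mul, hc, one_mul]

end Integral

section Shift

variable {X F U : Type*} [TopologicalSpace X] [AddGroup X] [ContinuousAdd X] [NormedField F]
  [NormedField U] [NormedAlgebra F U] {μ : BcoMeasure X F}

theorem weight_le_weight_shift (μ : BcoMeasure X F) (a x : X) :
    μ.weight x ≤ (μ.shift a).weight (x + a) := by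
  refine le_weight _ fun A hA => ?_
  refine (μ.weight_le_setNorm
    (A := clopenPreimage ⟨fun x => x + a, continuous_id.add continuous_const⟩ A) hA).trans ?_
  refine μ.setNorm_le fun B hB => ?_
  let B' : Clopens X := clopenPreimage ⟨fun x => x + -a, continuous_id.add continuous_const⟩ B
  have hB' : (μ.shift a).toFun B' = μ.toFun B := by
    refine congrArg μ.toFun (SetLike.ext fun z => ?_)
    change z + a + -a ∈ B ↔ z ∈ B
    rw [add_neg_cancel_right]
  rw [← hB']
  refine norm_toFun_le_setNorm _ fun z hz => ?_
  have h : z + -a + a ∈ A := hB (show z + -a ∈ B from hz)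
  rwa [neg_add_cancel_right] at h

/-- Change of variables for a translation. -/
theorem HasIntegral.of_shift {a : X} {φ : X → U} {I : U} (hI : (μ.shift a).HasIntegral φ I) :
    μ.HasIntegral (fun x => φ (x + a)) I := by
  intro ε hε
  obtain ⟨g, hg, hgφ, hgI⟩ := hI ε hε
  refine ⟨g.comap ⟨fun x => x + a, continuous_id.add continuous_const⟩,
    hg.subset (by rintro _ ⟨x, rfl⟩; exact ⟨x + a, rfl⟩), fun x => ?_, hgI⟩
  exact (mul_le_mul_of_nonneg_left (μ.weight_le_weight_shift a x) (norm_nonneg _)).trans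
    (hgφ (x + a))

end Shift

/-- Shifting a measure by `x₀` multiplies its characteristic functional by `y ↦ χ (y x₀)`. -/
theorem IsCharFunctional.eq_mul_of_shift {K X F U : Type*} [NontriviallyNormedField K]
    [NormedAddCommGroup X] [NormedSpace K X] [NormedField F] [IsUltrametricDist F] [NormedField U]
    [IsUltrametricDist U] [NormedAlgebra F U] {μ : BcoMeasure X F} {χ : AddChar K U}
    (hχ : ∀ a, ‖χ a‖ = 1) {θ θ' : StrongDual K X → U} {x₀ : X} (hθ : μ.IsCharFunctional χ θ)
    (hθ' : (μ.shift x₀).IsCharFunctional χ θ') (y : StrongDual K X) :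
    θ' y = χ (y x₀) * θ y := by
  refine (hθ' y).of_shift.unique ?_
  simpa only [map_add, AddChar.map_add_eq_mul, mul_comm] using
    (hθ y).const_mul_of_norm_eq_one (hχ (y x₀))

end BcoMeasure

theorem theorem18
    {K : Type*} [NontriviallyNormedField K] [IsUltrametricDist K] [LocallyCompactSpace K]
    {X : Type*} [NormedAddCommGroup X] [NormedSpace K X] [IsUltrametricDist X] [CompleteSpace X]
    [Nontrivial X]
    (hX : ∃ S : Set X, S.Countable ∧ Dense (Submodule.span K S : Set X))
    {s : ℕ} [Fact s.Prime]
    {Ks : Type*} [NontriviallyNormedField Ks] [IsUltrametricDist Ks] [LocallyCompactSpace Ks]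
    [NormedAlgebra ℚ_[s] Ks]
    {Us : Type*} [NormedField Us] [IsUltrametricDist Us] [CompleteSpace Us] [NormedAlgebra Ks Us]
    (χ : AddChar K Us) (hχ_cont : Continuous χ) (hχ_ne : χ ≠ 1)
    (hχ_root : ∀ a : K, ∃ n : ℕ, 0 < n ∧ χ a ^ n = 1) :
    ¬ ∃ μ : BcoMeasure X Ks, μ.IsUsualGaussian χ := by
  rintro ⟨μ, ⟨θ, hθ, hlim⟩, x₀, f, g, T, -, -, hθ'⟩
  have hχ : ∀ a, ‖χ a‖ = 1 := fun a => by
    obtain ⟨n, hn, h⟩ := hχ_root a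
    rw [← pow_eq_one_iff_of_nonneg (norm_nonneg _) hn.ne', ← norm_pow, h, norm_one]
  obtain ⟨y, hy⟩ := exists_strongDual_ne_zero_of_isUltrametricDist K X
  refine f.not_tendsto_sq_mul_zero (g (T y) (T y)) ?_
  rw [tendsto_zero_iff_norm_tendsto_zero]
  refine (hlim y hy).norm.congr' (.of_forall fun t => ?_) |>.trans (by rw [norm_zero])
  have h := hθ.eq_mul_of_shift hχ hθ' (t • y)
  have hq : g (T (t • y)) (T (t • y)) = t ^ 2 * g (T y) (T y) := by
    simp only [map_smul, LinearMap.smul_apply, smul_eq_mul]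
    ring
  rw [← hq, h, norm_mul, hχ, one_mul]
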